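/- Notation. $\mathcal M_d$ denotes the complex $d\times d$ matrices, and a state is a positive semidefinite matrix of trace one. All systems are finite dimensional. A state on $A\otimes B$ is separable ($A:B$) if it is a finite convex combination of product states. For states $\rho,\sigma$ let $D_{\max}(\rho\|\sigma)=\inf\{\lambda\ge 0:\rho\le 2^{\lambda}\sigma\}$ (with $\inf\emptyset=+\infty$), for a bipartite state $\rho_{AB}$ let $E_{\max}^{A:B}(\rho_{AB})=\inf\{D_{\max}(\rho_{AB}\|\sigma_{AB}):\sigma_{AB}\text{ separable}\}$, and for a quantum channel (completely positive trace-preserving linear map) $T:\mathcal M_{d_{A'}}\to\mathcal M_{d_{B'}}$ let $$E_{\max}(T)=\sup\{E_{\max}^{R:B'}\big((\mathrm{id}_R\otimes T)(\rho_{RA'})\big):\rho_{RA'}\text{ a state on }\mathbb C^{n}\otimes\mathbb C^{d_{A'}},\ n\in\mathbb N\}.$$ An LOCC-operation is a finite composition of product channels $\Phi_A\otimes\Phi_B$ of local channels and of maps $$X\mapsto\sum_{i,j}(K^A_i\otimes K^B_j)X(K^A_i\otimes K^B_j)^\dagger\otimes|j\rangle\langle j|_{A_c'}\otimes|i\rangle\langle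 i|_{B_c'},$$ where $\sum_i (K^A_i)^\dagger K^A_i=\mathbb 1$, $\sum_j (K^B_j)^\dagger K^B_j=\mathbb 1$, and the classical registers $A_c'$, $B_c'$ belong to the $A$ and the $B$ side respectively. A coding scheme with $m\ge 1$ uses of $T$ consists of memory dimensions $d_{A_i},d_{B_i}$ ($1\le i\le m$), an initial state $\rho^{(1)}_{A_1A'B_1}$ that is separable with respect to $A_1A':B_1$, LOCC-operations $L_i$ ($1\le i\le m-1$) from $A_i:B'B_i$ to $A_{i+1}A':B_{i+1}$, and an LOCC-operation $L_m$ from $A_m:B'B_m$ to $\tilde A:\tilde B$. Its output state $\phi^{(m)}_{\tilde A\tilde B}$ is obtained from $\rho^{(1)}$ by applying $T^{A'\to B'}, L_1, T^{A'\to B'}, L_2,\dots,T^{A'\to B'},L_m$ in this order. A private state with $K$-dimensional key part (on $A_kB_kA_sB_s$ with $d_{A_k}=d_{B_k}=K$, $d_{A_s}=d_{B_s}$) is a state $U(\omega_{A_kB_k}\otimes\sigma_{A_sB_s})U^\dagger$, where $\omega$ is the maximally entangled state in the computational basis, $\sigma_{A_sB_s}$ is any state and $U=\sum_{i,j}|i\rangle\langle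 i|_{A_k}\otimes|j\rangle\langle j|_{B_k}\otimes U^{ij}_{A_sB_s}$ with unitaries $U^{ij}$. A coding scheme with $m$ uses of $T$ is a $(k,m,\epsilon)$-coding scheme for private state generation assisted by classical communication if $\tilde A=A_kA_s$, $\tilde B=B_kB_s$ with $d_{A_k}=d_{B_k}=2^k$, $d_{A_s}=d_{B_s}$, and $\epsilon=\frac12\|\phi^{(m)}_{\tilde A\tilde B}-\gamma\|_1$ for some private state $\gamma$ with $2^k$-dimensional key part. Lemma. Let $T:\mathcal M_{d_{A'}}\to\mathcal M_{d_{B'}}$ be a quantum channel, $\alpha\in(1,\infty)$, $k,m\in\mathbb N$ with $m\ge1$. For every $(k,m,\epsilon)$-coding scheme for private state generation over $T$ assisted by classical communication, $E_{\max}(T)$ is finite and $$\epsilon\ \ge\ 1-2^{-\frac{\alpha-1}{2\alpha}\left(k-mE_{\max}(T)\right)}.$$ -/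

import Mathlib

open scoped ComplexOrder Kronecker ENNReal NNReal

namespace PrivCap

noncomputable section

/-- A quantum state (density matrix) on a finite system: positive semidefinite with trace one. -/
def IsState {A : Type*} [Fintype A] (ρ : Matrix A A ℂ) : Prop :=
  ρ.PosSemidef ∧ ρ.trace = 1

/-- Separable states on the bipartite system `A : B`: finite convex combinations of product
states. -/
def IsSeparable {A B : Type*} [Fintype A] [Fintype B] (σ : Matrix (A × B) (A × B) ℂ) : Prop :=
  ∃ (n : ℕ) (p : Fin n → ℝ) (ρ : Fin n → Matrix A A ℂ) (τ : Fin n → Matrix B B ℂ),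
    (∀ i, 0 ≤ p i) ∧ ∑ i, p i = 1 ∧ (∀ i, IsState (ρ i)) ∧ (∀ i, IsState (τ i)) ∧
      σ = ∑ i, p i • (ρ i ⊗ₖ τ i)

/-- Partial application `id_R ⊗ T` of a linear map to the second tensor factor. -/
def applySnd {R A B : Type*} (T : Matrix A A ℂ →ₗ[ℂ] Matrix B B ℂ)
    (X : Matrix (R × A) (R × A) ℂ) : Matrix (R × B) (R × B) ℂ :=
  Matrix.of fun p q => T (Matrix.of fun x y => X (p.1, x) (q.1, y)) p.2 q.2

/-- A quantum channel: a completely positive and trace-preserving linear map. -/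
structure IsQuantumChannel {A B : Type*} [Fintype A] [Fintype B]
    (T : Matrix A A ℂ →ₗ[ℂ] Matrix B B ℂ) : Prop where
  completelyPositive : ∀ (n : ℕ) (X : Matrix (Fin n × A) (Fin n × A) ℂ),
    X.PosSemidef → (applySnd T X).PosSemidef
  tracePreserving : ∀ X : Matrix A A ℂ, (T X).trace = X.trace

/-- Max-relative entropy (base 2): the infimum of all real `l ≥ 0` with `ρ ≤ 2 ^ l • σ`
in the Loewner order, and `∞` if there is none. -/
def Dmax {A : Type*} (ρ σ : Matrix A A ℂ) : ℝ≥0∞ :=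
  ⨅ (l : ℝ≥0) (_ : (((2 : ℝ) ^ (l : ℝ)) • σ - ρ).PosSemidef), (l : ℝ≥0∞)

/-- Max-relative entropy of entanglement of a bipartite state. -/
def EmaxState {A B : Type*} [Fintype A] [Fintype B] (ρ : Matrix (A × B) (A × B) ℂ) : ℝ≥0∞ :=
  ⨅ (σ : Matrix (A × B) (A × B) ℂ) (_ : IsSeparable σ), Dmax ρ σ

/-- Max-relative entropy of entanglement of a channel `T : M_a → M_b`: the supremum of the
max-relative entropy of entanglement of `(id ⊗ T) ρ` over all states `ρ` on `ℂⁿ ⊗ ℂᵃ` and all `n`. -/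
def Emax {a b : ℕ} (T : Matrix (Fin a) (Fin a) ℂ →ₗ[ℂ] Matrix (Fin b) (Fin b) ℂ) : ℝ≥0∞ :=
  ⨆ (n : ℕ) (ρ : Matrix (Fin n × Fin a) (Fin n × Fin a) ℂ) (_ : IsState ρ),
    EmaxState (applySnd T ρ)

/-- Kraus operators of a quantum channel from system `A` to system `A'`. -/
def IsKraus {I A A' : Type*} [Fintype I] [Fintype A'] [DecidableEq A]
    (K : I → Matrix A' A ℂ) : Prop :=
  ∑ i, (K i).conjTranspose * K i = 1

/-- The product of the local quantum channels with Kraus operators `K` on `A` and `L` on `B`. -/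
def localMap {I J A B A' B' : Type*} [Fintype I] [Fintype J] [Fintype A] [Fintype B]
    (K : I → Matrix A' A ℂ) (L : J → Matrix B' B ℂ) (X : Matrix (A × B) (A × B) ℂ) :
    Matrix (A' × B') (A' × B') ℂ :=
  ∑ i, ∑ j, (K i ⊗ₖ L j) * X * (K i ⊗ₖ L j).conjTranspose

/-- One round of local operations with exchange of outcomes: Kraus operators `K` on `A` and `L`
on `B` are applied, the outcome `j` of `B` is written into a classical register of `A`, and the
outcome `i` of `A` into a classical register of `B`. The tensor factors
`(A' ⊗ B') ⊗ (J ⊗ I)` are regrouped as `(A' ⊗ J) ⊗ (B' ⊗ I)`. -/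
def roundMap {I J A B A' B' : Type*} [Fintype I] [Fintype J] [DecidableEq I] [DecidableEq J]
    [Fintype A] [Fintype B]
    (K : I → Matrix A' A ℂ) (L : J → Matrix B' B ℂ) (X : Matrix (A × B) (A × B) ℂ) :
    Matrix ((A' × J) × (B' × I)) ((A' × J) × (B' × I)) ℂ :=
  (∑ i, ∑ j, ((K i ⊗ₖ L j) * X * (K i ⊗ₖ L j).conjTranspose) ⊗ₖ
      (Matrix.single j j (1 : ℂ) ⊗ₖ Matrix.single i i (1 : ℂ))).submatrix
    (Equiv.prodProdProdComm A' J B' I) (Equiv.prodProdProdComm A' J B' I)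

/-- LOCC-operations with respect to the bipartitions `A : B` (input) and `A' : B'` (output):
finite compositions of rounds of local operations with exchange of the outcomes, and of products
of local channels (identity, identification of isomorphic local systems, discarding of local
registers, ...). -/
inductive IsLOCC : {A B A' B' : Type} →
    (Matrix (A × B) (A × B) ℂ → Matrix (A' × B') (A' × B') ℂ) → Prop
  | protected loc {A B A' B' I J : Type} [Fintype I] [Fintype J] [Fintype A] [Fintype B]
      [Fintype A'] [Fintype B'] [DecidableEq A] [DecidableEq B]
      (K : I → Matrix A' A ℂ) (L : J → Matrix B' B ℂ) (hK : IsKraus K) (hL : IsKraus L) :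
      IsLOCC (localMap K L)
  | protected round {A B A' B' I J : Type} [Fintype I] [Fintype J] [DecidableEq I]
      [DecidableEq J] [Fintype A] [Fintype B]
      [Fintype A'] [Fintype B'] [DecidableEq A] [DecidableEq B]
      (K : I → Matrix A' A ℂ) (L : J → Matrix B' B ℂ) (hK : IsKraus K) (hL : IsKraus L) :
      IsLOCC (roundMap K L)
  | protected comp {A B C D A' B' : Type} [Fintype C] [Fintype D]
      {M : Matrix (C × D) (C × D) ℂ → Matrix (A' × B') (A' × B') ℂ}
      {N : Matrix (A × B) (A × B) ℂ → Matrix (C × D) (C × D) ℂ}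
      (hM : IsLOCC M) (hN : IsLOCC N) : IsLOCC (M ∘ N)

/-- One use of the channel `T` from Alice to Bob: `T` acts on the middle factor of
`A ⊗ A' ⊗ B`; before the use `A'` is held by Alice, afterwards the output `B'` is held by Bob. -/
def useChannel {A A' B B' : Type*} (T : Matrix A' A' ℂ →ₗ[ℂ] Matrix B' B' ℂ)
    (X : Matrix ((A × A') × B) ((A × A') × B) ℂ) :
    Matrix (A × (B' × B)) (A × (B' × B)) ℂ :=
  Matrix.of fun p q =>
    T (Matrix.of fun x y => X ((p.1, x), p.2.2) ((q.1, y), q.2.2)) p.2.1 q.2.1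

/-- A coding scheme assisted by two-way classical communication with `m ≥ 1` uses of `T` and
output systems `At : Bt`. Steps are numbered from `0`: `dA i`, `dB i` are the dimensions of the
memories of the two parties at the `(i+1)`-st use of the channel, `op i` is the LOCC-operation
between the `(i+1)`-st and the `(i+2)`-nd use (only those with `i + 1 < m` matter), and `last` is
the LOCC-operation after the `m`-th use. -/
structure CodingScheme {a b : ℕ} (T : Matrix (Fin a) (Fin a) ℂ →ₗ[ℂ] Matrix (Fin b) (Fin b) ℂ)
    (m : ℕ) (At Bt : Type) where
  pos : 0 < m
  dA : ℕ → ℕ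
  dB : ℕ → ℕ
  init : Matrix ((Fin (dA 0) × Fin a) × Fin (dB 0)) ((Fin (dA 0) × Fin a) × Fin (dB 0)) ℂ
  init_sep : IsSeparable init
  op : ∀ i : ℕ,
    Matrix (Fin (dA i) × (Fin b × Fin (dB i))) (Fin (dA i) × (Fin b × Fin (dB i))) ℂ →
      Matrix ((Fin (dA (i + 1)) × Fin a) × Fin (dB (i + 1)))
        ((Fin (dA (i + 1)) × Fin a) × Fin (dB (i + 1))) ℂ
  op_locc : ∀ i, i + 1 < m → IsLOCC (op i)
  last : Matrix (Fin (dA (m - 1)) × (Fin b × Fin (dB (m - 1))))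
      (Fin (dA (m - 1)) × (Fin b × Fin (dB (m - 1)))) ℂ →
    Matrix (At × Bt) (At × Bt) ℂ
  last_locc : IsLOCC last

namespace CodingScheme

variable {a b : ℕ} {T : Matrix (Fin a) (Fin a) ℂ →ₗ[ℂ] Matrix (Fin b) (Fin b) ℂ}
  {m : ℕ} {At Bt : Type}

/-- The state just before the `(i+1)`-st use of the channel. -/
def state (S : CodingScheme T m At Bt) : ∀ i : ℕ,
    Matrix ((Fin (S.dA i) × Fin a) × Fin (S.dB i)) ((Fin (S.dA i) × Fin a) × Fin (S.dB i)) ℂ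
  | 0 => S.init
  | i + 1 => S.op i (useChannel T (S.state i))

/-- The output state of the coding scheme, after `m` channel uses. -/
def output (S : CodingScheme T m At Bt) : Matrix (At × Bt) (At × Bt) ℂ :=
  S.last (useChannel T (S.state (m - 1)))

end CodingScheme

/-- The maximally entangled state on `ℂᴷ ⊗ ℂᴷ` in the computational basis. -/
def maxEntangled (K : ℕ) : Matrix (Fin K × Fin K) (Fin K × Fin K) ℂ :=
  Matrix.of fun p q => if p.1 = p.2 ∧ q.1 = q.2 then (1 / (K : ℂ)) else 0

/-- The twisting unitary `∑ i j, |i⟩⟨i| ⊗ |j⟩⟨j| ⊗ U i j`. -/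
def twisting {K d : ℕ}
    (U : Fin K → Fin K → Matrix (Fin d × Fin d) (Fin d × Fin d) ℂ) :
    Matrix ((Fin K × Fin K) × (Fin d × Fin d)) ((Fin K × Fin K) × (Fin d × Fin d)) ℂ :=
  ∑ i, ∑ j, (Matrix.single i i (1 : ℂ) ⊗ₖ Matrix.single j j (1 : ℂ)) ⊗ₖ U i j

/-- Private states with `K`-dimensional key part and shield dimensions `d`, on the tensor
factors `(A_k ⊗ B_k) ⊗ (A_s ⊗ B_s)`. -/
def IsPrivateState (K d : ℕ)
    (γ : Matrix ((Fin K × Fin K) × (Fin d × Fin d)) ((Fin K × Fin K) × (Fin d × Fin d)) ℂ) :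
    Prop :=
  ∃ (σ : Matrix (Fin d × Fin d) (Fin d × Fin d) ℂ)
    (U : Fin K → Fin K → Matrix (Fin d × Fin d) (Fin d × Fin d) ℂ),
    IsState σ ∧ (∀ i j, U i j ∈ Matrix.unitaryGroup (Fin d × Fin d) ℂ) ∧
      γ = twisting U * (maxEntangled K ⊗ₖ σ) * (twisting U).conjTranspose

/-- The trace norm: the sum of the singular values, that is, of the square roots of the
eigenvalues of `Xᴴ * X`. -/
def traceNorm {n : Type*} [Fintype n] [DecidableEq n] (X : Matrix n n ℂ) : ℝ :=
  ∑ i, Real.sqrt ((Matrix.isHermitian_conjTranspose_mul_self X).eigenvalues i)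

/-- `S` is a `(k, m, ε)`-coding scheme for private state generation assisted by classical
communication, with shield dimensions `d`: the output systems are `A_k ⊗ A_s` and `B_k ⊗ B_s`
with key dimensions `2 ^ k`, and the output state has trace distance `ε` to a private state
(whose tensor factors are regrouped from `(A_k ⊗ B_k) ⊗ (A_s ⊗ B_s)`). -/
def CodingScheme.IsPrivate {a b : ℕ}
    {T : Matrix (Fin a) (Fin a) ℂ →ₗ[ℂ] Matrix (Fin b) (Fin b) ℂ} {k m d : ℕ}
    (S : CodingScheme T m (Fin (2 ^ k) × Fin d) (Fin (2 ^ k) × Fin d)) (ε : ℝ) : Prop :=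
  ∃ γ, IsPrivateState (2 ^ k) d γ ∧
    ε = 1 / 2 * traceNorm (S.output - γ.submatrix
      (Equiv.prodProdProdComm (Fin (2 ^ k)) (Fin d) (Fin (2 ^ k)) (Fin d))
      (Equiv.prodProdProdComm (Fin (2 ^ k)) (Fin d) (Fin (2 ^ k)) (Fin d)))

end

end PrivCap

/-!
The proof gives the stronger bound `1 - 2 ^ (-(k - m * Emax T)) ≤ ε`; the factor
`(α - 1) / (2 * α)`, which lies in `(0, 1]`, only weakens it, and where `k - m * Emax T` is negative
the claim follows from `0 ≤ ε`.

The quantity followed through the coding scheme is a separable upper bound: an element `Z` of the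
cone of unnormalized separable matrices (`sepCone`) with `state ≤ Z` in the Loewner order
(`IsDominated`). The initial state is its own upper bound, of trace one. LOCC-operations have product
Kraus operators, so they are positive and map the separable cone into itself without changing the
trace (`IsLOCC.exists_isSepOperation`). One use of `T` multiplies the trace of the upper bound by at
most `2 ^ l`, for any `l > Emax T` (`IsDominated.useChannel`): if the bound is `∑ X ⊗ Y` across the cut
`A A' : B`, then `T` acts on the factors `X` only, and by definition of `Emax` each `(id ⊗ T) X` lies
below a separable matrix of trace `2 ^ l * tr X`. The output thus has a separable upper bound of
trace `2 ^ (m * l)`.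

The output is compared with the private state by the privacy test, the projection
`Π = (1 / K) Vᴴ V` with `V = untwist U` and `K = 2 ^ k`. The private state passes it with certainty,
whereas a separable matrix `Z` passes with weight at most `tr Z / K` (`trace_untwist_le`). The trace
norm dominates `|tr (W X)|` for the unitary `W = 2 Π - 1` (`norm_trace_mul_le_traceNorm`), and this
gives `1 - 2 ^ (m * l) / K ≤ ε` (`IsDominated.one_sub_le`); then `l` tends to `Emax T`.

`Emax T` is finite by the pinching inequality `ρ ≤ |B| • dephase ρ`, whose right-hand side is
separable of trace `|B|` independently of the reference system (`emaxState_le_logb_card`).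
-/

namespace PrivCap

open Matrix

/-! ### The cone of separable matrices -/

section SepCone

variable {A B A' B' : Type*}

/-- The cone of unnormalized separable matrices on `A : B`: finite sums of tensor products of
positive semidefinite matrices. -/
def sepCone (A B : Type*) : AddSubmonoid (Matrix (A × B) (A × B) ℂ) :=
  AddSubmonoid.closure {Z | ∃ X : Matrix A A ℂ, ∃ Y : Matrix B B ℂ,
    X.PosSemidef ∧ Y.PosSemidef ∧ Z = X ⊗ₖ Y}

lemma kronecker_mem_sepCone {X : Matrix A A ℂ} {Y : Matrix B B ℂ} (hX : X.PosSemidef)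
    (hY : Y.PosSemidef) : X ⊗ₖ Y ∈ sepCone A B :=
  AddSubmonoid.subset_closure ⟨X, Y, hX, hY, rfl⟩

/-- Membership of the image of a separable matrix in a monoid can be checked on tensor products of
positive semidefinite matrices. -/
lemma map_mem_of_mem_sepCone {M : Type*} [AddMonoid M] (f : Matrix (A × B) (A × B) ℂ →+ M)
    (S : AddSubmonoid M)
    (hf : ∀ (X : Matrix A A ℂ) (Y : Matrix B B ℂ), X.PosSemidef → Y.PosSemidef → f (X ⊗ₖ Y) ∈ S)
    {Z : Matrix (A × B) (A × B) ℂ} (hZ : Z ∈ sepCone A B) : f Z ∈ S := by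
  have h : sepCone A B ≤ S.comap f := by
    refine AddSubmonoid.closure_le.2 ?_
    rintro _ ⟨X, Y, hX, hY, rfl⟩
    exact hf X Y hX hY
  exact h hZ

lemma posSemidef_of_mem_sepCone [Finite A] [Finite B] {Z : Matrix (A × B) (A × B) ℂ}
    (hZ : Z ∈ sepCone A B) : Z.PosSemidef := by
  induction hZ using AddSubmonoid.closure_induction with
  | mem Z h => obtain ⟨X, Y, hX, hY, rfl⟩ := h; exact hX.kronecker hY
  | zero => exact PosSemidef.zero
  | add X Y _ _ hX hY => exact hX.add hY

lemma smul_mem_sepCone {t : ℝ} (ht : 0 ≤ t) {Z : Matrix (A × B) (A × B) ℂ}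
    (hZ : Z ∈ sepCone A B) : t • Z ∈ sepCone A B := by
  refine map_mem_of_mem_sepCone (DistribSMul.toAddMonoidHom _ t) _ (fun X Y hX hY => ?_) hZ
  have : t • (X ⊗ₖ Y) = (t • X) ⊗ₖ Y := (smul_kronecker _ _ _).symm
  simpa [this] using kronecker_mem_sepCone (hX.smul ht) hY

/-- A nonzero positive semidefinite matrix is a positive multiple of a state. -/
lemma isState_inv_trace_smul [Fintype A] {X : Matrix A A ℂ} (hX : X.PosSemidef)
    (h0 : X.trace ≠ 0) : 0 < X.trace.re ∧ X.trace = (X.trace.re : ℂ) ∧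
      IsState ((X.trace.re)⁻¹ • X) ∧ X = X.trace.re • ((X.trace.re)⁻¹ • X) := by
  have h1 := Complex.nonneg_iff.1 hX.trace_nonneg
  have h2 : X.trace = (X.trace.re : ℂ) := Complex.ext rfl (by simp [← h1.2])
  have h3 : X.trace.re ≠ 0 := fun h => h0 (by rw [h2, h]; simp)
  refine ⟨lt_of_le_of_ne h1.1 h3.symm, h2, ⟨hX.smul (inv_nonneg.2 h1.1), ?_⟩, ?_⟩
  · rw [trace_smul, h2]
    simp [h3]
  · rw [smul_smul, mul_inv_cancel₀ h3, one_smul]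

/-- Separable states are the elements of trace one of the separable cone. -/
lemma isSeparable_iff [Fintype A] [Fintype B] {σ : Matrix (A × B) (A × B) ℂ} :
    IsSeparable σ ↔ σ ∈ sepCone A B ∧ σ.trace = 1 := by
  constructor
  · rintro ⟨n, p, ρ, τ, hp, hp1, hρ, hτ, rfl⟩
    refine ⟨sum_mem fun i _ => smul_mem_sepCone (hp i)
      (kronecker_mem_sepCone (hρ i).1 (hτ i).1), ?_⟩
    rw [trace_sum]
    simp only [trace_smul, trace_kronecker, (hρ _).2, (hτ _).2, mul_one, Complex.real_smul]
    rw [← Complex.ofReal_sum, hp1, Complex.ofReal_one]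
  · rintro ⟨hσ, h1⟩
    -- any element of the cone is a nonnegative combination of product states; summands whose
    -- factors have trace zero vanish, and the trace fixes the sum of the coefficients
    have key : ∃ (n : ℕ) (p : Fin n → ℝ) (ρ : Fin n → Matrix A A ℂ) (τ : Fin n → Matrix B B ℂ),
        (∀ i, 0 ≤ p i) ∧ (∀ i, IsState (ρ i)) ∧ (∀ i, IsState (τ i)) ∧
          σ = ∑ i, p i • (ρ i ⊗ₖ τ i) := by
      clear h1
      induction hσ using AddSubmonoid.closure_induction with
      | mem Z h =>
        obtain ⟨X, Y, hX, hY, rfl⟩ := h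
        by_cases hx : X.trace = 0
        · rw [hX.trace_eq_zero_iff] at hx
          exact ⟨0, Fin.elim0, Fin.elim0, Fin.elim0, fun i => i.elim0, fun i => i.elim0,
            fun i => i.elim0, by simp [hx]⟩
        by_cases hy : Y.trace = 0
        · rw [hY.trace_eq_zero_iff] at hy
          exact ⟨0, Fin.elim0, Fin.elim0, Fin.elim0, fun i => i.elim0, fun i => i.elim0,
            fun i => i.elim0, by simp [hy]⟩
        obtain ⟨x0, -, xs, xe⟩ := isState_inv_trace_smul hX hx
        obtain ⟨y0, -, ys, ye⟩ := isState_inv_trace_smul hY hy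
        refine ⟨1, fun _ => X.trace.re * Y.trace.re, fun _ => (X.trace.re)⁻¹ • X,
          fun _ => (Y.trace.re)⁻¹ • Y, fun _ => (mul_pos x0 y0).le, fun _ => xs, fun _ => ys, ?_⟩
        rw [Fin.sum_univ_one, mul_smul, ← kronecker_smul, ← ye, ← smul_kronecker, ← xe]
      | zero =>
        exact ⟨0, Fin.elim0, Fin.elim0, Fin.elim0, fun i => i.elim0, fun i => i.elim0,
          fun i => i.elim0, by simp⟩
      | add X Y _ _ hX hY =>
        obtain ⟨n, p, ρ, τ, hp, hρ, hτ, rfl⟩ := hX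
        obtain ⟨n', p', ρ', τ', hp', hρ', hτ', rfl⟩ := hY
        refine ⟨n + n', Fin.append p p', Fin.append ρ ρ', Fin.append τ τ', ?_, ?_, ?_, ?_⟩
        · intro i; refine Fin.addCases (fun i => ?_) (fun i => ?_) i <;> simp [hp, hp']
        · intro i; refine Fin.addCases (fun i => ?_) (fun i => ?_) i <;> simp [hρ, hρ']
        · intro i; refine Fin.addCases (fun i => ?_) (fun i => ?_) i <;> simp [hτ, hτ']
        · simp [Fin.sum_univ_add]
    obtain ⟨n, p, ρ, τ, hp, hρ, hτ, rfl⟩ := key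
    refine ⟨n, p, ρ, τ, hp, ?_, hρ, hτ, rfl⟩
    rw [trace_sum] at h1
    simp only [trace_smul, trace_kronecker, (hρ _).2, (hτ _).2, mul_one, Complex.real_smul] at h1
    exact_mod_cast h1

lemma isState_of_isSeparable [Fintype A] [Fintype B] {σ : Matrix (A × B) (A × B) ℂ}
    (h : IsSeparable σ) : IsState σ :=
  ⟨posSemidef_of_mem_sepCone (isSeparable_iff.1 h).1, (isSeparable_iff.1 h).2⟩

end SepCone

/-! ### LOCC-operations -/

section LOCC

/-- The properties of LOCC-operations that the converse bound uses: they are linear,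
positive, trace preserving, and map the separable cone into the separable cone. -/
structure IsSepOperation {A B A' B' : Type*} [Fintype A] [Fintype B] [Fintype A'] [Fintype B']
    (f : Matrix (A × B) (A × B) ℂ →ₗ[ℂ] Matrix (A' × B') (A' × B') ℂ) : Prop where
  posSemidef : ∀ X, X.PosSemidef → (f X).PosSemidef
  sepCone : ∀ X ∈ sepCone A B, f X ∈ sepCone A' B'
  trace : ∀ X, (f X).trace = X.trace

variable {A B A' B' : Type*} [Fintype A] [Fintype B]

/-- The completely positive map `X ↦ ∑ r, (P r ⊗ Q r) X (P r ⊗ Q r)ᴴ` whose Kraus operators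
are tensor products. -/
def productKrausMap {R : Type*} [Fintype R] (P : R → Matrix A' A ℂ) (Q : R → Matrix B' B ℂ) :
    Matrix (A × B) (A × B) ℂ →ₗ[ℂ] Matrix (A' × B') (A' × B') ℂ where
  toFun X := ∑ r, (P r ⊗ₖ Q r) * X * (P r ⊗ₖ Q r)ᴴ
  map_add' X Y := by simp [Matrix.mul_add, Matrix.add_mul, Finset.sum_add_distrib]
  map_smul' c X := by simp [Finset.smul_sum]

lemma isSepOperation_productKrausMap [Fintype A'] [Fintype B'] [DecidableEq A] [DecidableEq B]
    {R : Type*} [Fintype R]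
    (P : R → Matrix A' A ℂ) (Q : R → Matrix B' B ℂ)
    (h : ∑ r, ((P r)ᴴ * P r) ⊗ₖ ((Q r)ᴴ * Q r) = 1) :
    IsSepOperation (productKrausMap P Q) where
  posSemidef X hX := posSemidef_sum _ fun r _ => hX.mul_mul_conjTranspose_same _
  sepCone X hX := by
    refine map_mem_of_mem_sepCone (productKrausMap P Q).toAddMonoidHom _ (fun X Y hX hY => ?_) hX
    refine sum_mem fun r _ => ?_
    rw [conjTranspose_kronecker, ← mul_kronecker_mul, ← mul_kronecker_mul]
    exact kronecker_mem_sepCone (hX.mul_mul_conjTranspose_same _)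
      (hY.mul_mul_conjTranspose_same _)
  trace X := by
    change (∑ r, (P r ⊗ₖ Q r) * X * (P r ⊗ₖ Q r)ᴴ).trace = X.trace
    have h' : ∀ r, ((P r ⊗ₖ Q r) * X * (P r ⊗ₖ Q r)ᴴ).trace
        = ((((P r)ᴴ * P r) ⊗ₖ ((Q r)ᴴ * Q r)) * X).trace := fun r => by
      rw [trace_mul_comm, ← Matrix.mul_assoc, conjTranspose_kronecker, ← mul_kronecker_mul]
    rw [trace_sum]
    simp only [h']
    rw [← trace_sum, ← Finset.sum_mul, h, Matrix.one_mul]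

omit [Fintype A] [Fintype B] in
lemma sum_kraus_kronecker {I J : Type*} [Fintype I] [Fintype J] [Fintype A'] [Fintype B']
    [DecidableEq A] [DecidableEq B] {K : I → Matrix A' A ℂ} {L : J → Matrix B' B ℂ}
    (hK : IsKraus K) (hL : IsKraus L) :
    ∑ r : I × J, ((K r.1)ᴴ * K r.1) ⊗ₖ ((L r.2)ᴴ * L r.2) = 1 := by
  have h : ∑ r : I × J, ((K r.1)ᴴ * K r.1) ⊗ₖ ((L r.2)ᴴ * L r.2)
      = (∑ i, (K i)ᴴ * K i) ⊗ₖ (∑ j, (L j)ᴴ * L j) := by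
    ext p q
    simp only [Matrix.sum_apply, kroneckerMap_apply, Fintype.sum_prod_type, Finset.sum_mul_sum]
  rw [h, show ∑ i, (K i)ᴴ * K i = 1 from hK, show ∑ j, (L j)ᴴ * L j = 1 from hL,
    one_kronecker_one]

/-- The operator `|x⟩ ↦ (K |x⟩) ⊗ |j⟩`, which appends a classical register in the state `j`. -/
def appendRegister {J : Type*} [DecidableEq J] (K : Matrix A' A ℂ) (j : J) :
    Matrix (A' × J) A ℂ :=
  Matrix.of fun p x => if p.2 = j then K p.1 x else 0

omit [Fintype A] in
lemma appendRegister_conjTranspose_mul_self {J : Type*} [Fintype J] [Fintype A'] [DecidableEq J]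
    (K : Matrix A' A ℂ) (j : J) :
    (appendRegister K j)ᴴ * appendRegister K j = Kᴴ * K := by
  ext x y
  simp [Matrix.mul_apply, appendRegister, Fintype.sum_prod_type]

lemma single_self_apply {N : Type*} [DecidableEq N] (n x y : N) :
    Matrix.single n n (1 : ℂ) x y = if x = n ∧ y = n then 1 else 0 := by
  simp [Matrix.single_apply, eq_comm]

/-- A round with exchange of outcomes has product Kraus operators: for the outcomes `i` and `j`,
party `A` applies `K i` and records `j`, while party `B` applies `L j` and records `i`. -/
lemma roundMap_eq {I J : Type*} [Fintype I] [Fintype J] [DecidableEq I] [DecidableEq J]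
    (K : I → Matrix A' A ℂ) (L : J → Matrix B' B ℂ) (X : Matrix (A × B) (A × B) ℂ) :
    roundMap K L X = productKrausMap (fun r : I × J => appendRegister (K r.1) r.2)
      (fun r => appendRegister (L r.2) r.1) X := by
  have h : ∀ (i : I) (j : J),
      (((K i ⊗ₖ L j) * X * (K i ⊗ₖ L j)ᴴ) ⊗ₖ
        (Matrix.single j j (1 : ℂ) ⊗ₖ Matrix.single i i (1 : ℂ))).submatrix
          (Equiv.prodProdProdComm A' J B' I) (Equiv.prodProdProdComm A' J B' I)
      = (appendRegister (K i) j ⊗ₖ appendRegister (L j) i) * X *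
          (appendRegister (K i) j ⊗ₖ appendRegister (L j) i)ᴴ := by
    intro i j
    ext ⟨⟨a, j1⟩, ⟨b, i1⟩⟩ ⟨⟨a', j2⟩, ⟨b', i2⟩⟩
    by_cases h1 : j1 = j <;> by_cases h2 : i1 = i <;> by_cases h3 : j2 = j <;>
      by_cases h4 : i2 = i <;>
      simp [Matrix.mul_apply, appendRegister, single_self_apply, h1, h2, h3, h4]
  simp only [productKrausMap, LinearMap.coe_mk, AddHom.coe_mk, Fintype.sum_prod_type, ← h]
  ext p q
  simp [roundMap, Matrix.sum_apply]

lemma IsLOCC.exists_isSepOperation {A B A' B' : Type}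
    {M : Matrix (A × B) (A × B) ℂ → Matrix (A' × B') (A' × B') ℂ} (hM : IsLOCC M) :
    ∀ [Fintype A] [Fintype B] [Fintype A'] [Fintype B'],
    ∃ f : Matrix (A × B) (A × B) ℂ →ₗ[ℂ] Matrix (A' × B') (A' × B') ℂ,
      IsSepOperation f ∧ ⇑f = M := by
  induction hM with
  | @loc A B A' B' I J _ _ jA jB jA' jB' _ _ K L hK hL =>
    intro iA iB iA' iB'
    obtain rfl := Subsingleton.elim iA jA
    obtain rfl := Subsingleton.elim iB jB
    obtain rfl := Subsingleton.elim iA' jA'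
    obtain rfl := Subsingleton.elim iB' jB'
    refine ⟨productKrausMap (fun r : I × J => K r.1) (fun r => L r.2),
      isSepOperation_productKrausMap _ _ (sum_kraus_kronecker hK hL), ?_⟩
    ext1 X
    simp only [productKrausMap, LinearMap.coe_mk, AddHom.coe_mk, Fintype.sum_prod_type]
    rfl
  | @round A B A' B' I J _ _ _ _ jA jB jA' jB' _ _ K L hK hL =>
    intro iA iB iA' iB'
    obtain rfl := Subsingleton.elim iA jA
    obtain rfl := Subsingleton.elim iB jB
    obtain rfl := Subsingleton.elim iA' (instFintypeProd A' J)
    obtain rfl := Subsingleton.elim iB' (instFintypeProd B' I)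
    refine ⟨productKrausMap (fun r : I × J => appendRegister (K r.1) r.2)
      (fun r => appendRegister (L r.2) r.1), isSepOperation_productKrausMap _ _ ?_, ?_⟩
    · simpa only [appendRegister_conjTranspose_mul_self] using sum_kraus_kronecker hK hL
    · ext1 X
      exact (roundMap_eq K L X).symm
  | comp hM hN ihM ihN =>
    intro _ _ _ _
    obtain ⟨f, hf, rfl⟩ := ihM
    obtain ⟨g, hg, rfl⟩ := ihN
    exact ⟨f ∘ₗ g, ⟨fun X h => hf.posSemidef _ (hg.posSemidef _ h),
      fun X h => hf.sepCone _ (hg.sepCone _ h), fun X => (hf.trace _).trans (hg.trace _)⟩, rfl⟩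

end LOCC

/-! ### Partial application of a channel -/

section Channel

variable {R A A' B B' : Type*}

lemma IsQuantumChannel.posSemidef_applySnd [Fintype R] [Fintype A] [Fintype B]
    {T : Matrix A A ℂ →ₗ[ℂ] Matrix B B ℂ} (hT : IsQuantumChannel T)
    {X : Matrix (R × A) (R × A) ℂ} (hX : X.PosSemidef) : (applySnd T X).PosSemidef := by
  let e := Fintype.equivFin R
  have h := (hT.completelyPositive _ _ (hX.submatrix (Prod.map e.symm id))).submatrix
    (Prod.map e id)
  convert h
  ext p q
  simp [applySnd]

lemma IsQuantumChannel.trace_applySnd [Fintype R] [Fintype A] [Fintype B]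
    {T : Matrix A A ℂ →ₗ[ℂ] Matrix B B ℂ} (hT : IsQuantumChannel T)
    (X : Matrix (R × A) (R × A) ℂ) : (applySnd T X).trace = X.trace := by
  have h := fun r : R => hT.tracePreserving (Matrix.of fun x y => X (r, x) (r, y))
  simp only [Matrix.trace, Matrix.diag, of_apply, applySnd, Fintype.sum_prod_type] at h ⊢
  exact Finset.sum_congr rfl fun r _ => h r

lemma applySnd_zero (T : Matrix A A ℂ →ₗ[ℂ] Matrix B B ℂ) :
    applySnd T (0 : Matrix (R × A) (R × A) ℂ) = 0 := by
  ext p q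
  exact congrFun (congrFun (map_zero T) p.2) q.2

lemma applySnd_smul (T : Matrix A A ℂ →ₗ[ℂ] Matrix B B ℂ) (t : ℝ)
    (X : Matrix (R × A) (R × A) ℂ) : applySnd T (t • X) = t • applySnd T X := by
  ext p q
  exact congrFun (congrFun (LinearMap.map_smul_of_tower T t
    (Matrix.of fun x y => X (p.1, x) (q.1, y))) p.2) q.2

lemma useChannel_add (T : Matrix A' A' ℂ →ₗ[ℂ] Matrix B' B' ℂ)
    (X Y : Matrix ((A × A') × B) ((A × A') × B) ℂ) :
    useChannel T (X + Y) = useChannel T X + useChannel T Y := by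
  ext p q
  exact congrFun (congrFun (map_add T
    (Matrix.of fun x y => X ((p.1, x), p.2.2) ((q.1, y), q.2.2))
    (Matrix.of fun x y => Y ((p.1, x), p.2.2) ((q.1, y), q.2.2))) p.2.1) q.2.1

lemma useChannel_zero (T : Matrix A' A' ℂ →ₗ[ℂ] Matrix B' B' ℂ) :
    useChannel T (0 : Matrix ((A × A') × B) ((A × A') × B) ℂ) = 0 := by
  ext p q
  exact congrFun (congrFun (map_zero T) p.2.1) q.2.1

lemma useChannel_kronecker (T : Matrix A' A' ℂ →ₗ[ℂ] Matrix B' B' ℂ)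
    (X : Matrix (A × A') (A × A') ℂ) (Y : Matrix B B ℂ) :
    useChannel T (X ⊗ₖ Y) =
      (applySnd T X ⊗ₖ Y).submatrix (Equiv.prodAssoc A B' B).symm (Equiv.prodAssoc A B' B).symm := by
  ext p q
  have h := congrFun (congrFun (map_smul T (Y p.2.2 q.2.2)
    (Matrix.of fun x y => X (p.1, x) (q.1, y))) p.2.1) q.2.1
  have e : (Matrix.of fun x y => (X ⊗ₖ Y) ((p.1, x), p.2.2) ((q.1, y), q.2.2))
      = Y p.2.2 q.2.2 • (Matrix.of fun x y => X (p.1, x) (q.1, y)) := by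
    ext x y
    simp [mul_comm]
  simp only [useChannel, of_apply, e]
  rw [h]
  simp [applySnd, mul_comm]

lemma IsQuantumChannel.posSemidef_useChannel [Fintype A] [Fintype A'] [Fintype B] [Fintype B']
    {T : Matrix A' A' ℂ →ₗ[ℂ] Matrix B' B' ℂ} (hT : IsQuantumChannel T)
    {X : Matrix ((A × A') × B) ((A × A') × B) ℂ} (hX : X.PosSemidef) :
    (useChannel T X).PosSemidef :=
  -- both memories together form the reference system
  (hT.posSemidef_applySnd (R := A × B)
    (hX.submatrix fun r : (A × B) × A' => ((r.1.1, r.2), r.1.2))).submatrix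
      fun p : A × (B' × B) => ((p.1, p.2.2), p.2.1)

lemma IsQuantumChannel.trace_useChannel [Fintype A] [Fintype A'] [Fintype B] [Fintype B']
    {T : Matrix A' A' ℂ →ₗ[ℂ] Matrix B' B' ℂ} (hT : IsQuantumChannel T)
    (X : Matrix ((A × A') × B) ((A × A') × B) ℂ) : (useChannel T X).trace = X.trace := by
  have h := fun (r : A) (s : B) =>
    hT.tracePreserving (Matrix.of fun x y => X ((r, x), s) ((r, y), s))
  simp only [Matrix.trace, Matrix.diag, of_apply, useChannel, Fintype.sum_prod_type] at h ⊢
  refine Finset.sum_congr rfl fun r _ => ?_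
  rw [Finset.sum_comm]
  conv_rhs => rw [Finset.sum_comm]
  exact Finset.sum_congr rfl fun s _ => h r s

lemma kronecker_submatrix_prodAssoc_mem_sepCone {Z : Matrix (A × B') (A × B') ℂ}
    (hZ : Z ∈ sepCone A B') {Y : Matrix B B ℂ} [Finite B] [Finite B'] (hY : Y.PosSemidef) :
    (Z ⊗ₖ Y).submatrix (Equiv.prodAssoc A B' B).symm (Equiv.prodAssoc A B' B).symm ∈
      sepCone A (B' × B) := by
  induction hZ using AddSubmonoid.closure_induction with
  | mem Z h =>
    obtain ⟨X, Y', hX, hY', rfl⟩ := h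
    have e : ((X ⊗ₖ Y') ⊗ₖ Y).submatrix (Equiv.prodAssoc A B' B).symm
        (Equiv.prodAssoc A B' B).symm = X ⊗ₖ (Y' ⊗ₖ Y) := by
      ext p q
      simp [mul_assoc]
    rw [e]
    exact kronecker_mem_sepCone hX (hY'.kronecker hY)
  | zero => rw [zero_kronecker, submatrix_zero]; exact zero_mem _
  | add X Y _ _ hX hY =>
    rw [add_kronecker, submatrix_add]
    exact add_mem hX hY

end Channel

/-! ### Max-relative entropy of entanglement along a coding scheme -/

section Emax

variable {A B : Type*} [Fintype A] [Fintype B]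

lemma exists_isSeparable_of_emaxState_lt {ρ : Matrix (A × B) (A × B) ℂ} {l : ℝ≥0}
    (h : EmaxState ρ < l) :
    ∃ σ, IsSeparable σ ∧ ((2 : ℝ) ^ (l : ℝ) • σ - ρ).PosSemidef := by
  simp only [EmaxState, Dmax, iInf_lt_iff] at h
  obtain ⟨σ, hσ, l', hl', h⟩ := h
  refine ⟨σ, hσ, ?_⟩
  have h1 : (2 : ℝ) ^ (l' : ℝ) ≤ (2 : ℝ) ^ (l : ℝ) :=
    Real.rpow_le_rpow_of_exponent_le one_le_two (by exact_mod_cast h.le)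
  have h2 := ((isState_of_isSeparable hσ).1.smul (sub_nonneg.2 h1)).add hl'
  rwa [sub_smul, sub_add_sub_cancel] at h2

/-- Dephasing the second factor: `ρ` is replaced by its blocks that are diagonal with respect to
the computational basis of `B`. -/
def dephase [DecidableEq B] (ρ : Matrix (A × B) (A × B) ℂ) : Matrix (A × B) (A × B) ℂ :=
  ∑ b, (ρ.submatrix (fun r => (r, b)) fun r => (r, b)) ⊗ₖ Matrix.single b b 1

omit [Fintype A] in
lemma dephase_apply [DecidableEq B] (ρ : Matrix (A × B) (A × B) ℂ) (p q : A × B) :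
    dephase ρ p q = if p.2 = q.2 then ρ p q else 0 := by
  obtain ⟨p, x⟩ := p
  obtain ⟨q, y⟩ := q
  simp [dephase, Matrix.sum_apply, single_self_apply, ite_and]
  grind

omit [Fintype A] in
lemma dephase_mem_sepCone [DecidableEq B] {ρ : Matrix (A × B) (A × B) ℂ} (hρ : ρ.PosSemidef) :
    dephase ρ ∈ sepCone A B := by
  refine sum_mem fun b _ => kronecker_mem_sepCone (hρ.submatrix _) ?_
  rw [← diagonal_single]
  exact PosSemidef.diagonal (by simp [Pi.single_nonneg])

lemma trace_dephase [DecidableEq B] (ρ : Matrix (A × B) (A × B) ℂ) :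
    (dephase ρ).trace = ρ.trace := by
  simp [Matrix.trace, dephase_apply]

/-- The pinching inequality `ρ ≤ |B| • dephase ρ`. It holds because twice the difference is the sum
of the matrices `(P x - P y) ρ (P x - P y)` over all pairs of basis projections `P x`, `P y`
on `B`. -/
lemma posSemidef_card_smul_dephase_sub [DecidableEq A] [DecidableEq B]
    {ρ : Matrix (A × B) (A × B) ℂ} (hρ : ρ.PosSemidef) :
    ((Fintype.card B : ℝ) • dephase ρ - ρ).PosSemidef := by
  let D : B → B → Matrix (A × B) (A × B) ℂ := fun x y =>
    diagonal fun p => (if x = p.2 then 1 else 0) - (if y = p.2 then 1 else 0)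
  have h : (∑ x, ∑ y, D x y * ρ * (D x y)ᴴ).PosSemidef :=
    posSemidef_sum _ fun x _ => posSemidef_sum _ fun y _ => hρ.mul_mul_conjTranspose_same _
  have e : (Fintype.card B : ℝ) • dephase ρ - ρ
      = (1 / 2 : ℝ) • ∑ x, ∑ y, D x y * ρ * (D x y)ᴴ := by
    ext p q
    have h1 : ∀ x y, (D x y * ρ * (D x y)ᴴ) p q =
        (((if x = p.2 then 1 else 0) - (if y = p.2 then 1 else 0)) *
          ((if x = q.2 then 1 else 0) - (if y = q.2 then 1 else 0))) * ρ p q := by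
      intro x y
      simp only [D, diagonal_conjTranspose, mul_diagonal, diagonal_mul, Pi.star_apply, star_sub,
        apply_ite star, star_one, star_zero]
      ring
    have h2 : ∑ x : B, ∑ y : B, (((if x = p.2 then (1 : ℂ) else 0) - (if y = p.2 then 1 else 0)) *
          ((if x = q.2 then 1 else 0) - (if y = q.2 then 1 else 0)))
        = 2 * ((Fintype.card B : ℂ) * (if p.2 = q.2 then 1 else 0) - 1) := by
      rcases eq_or_ne p.2 q.2 with h | h
      · simp [mul_sub, Finset.sum_sub_distrib, h]
        ring
      · simp [mul_sub, Finset.sum_sub_distrib, h, h.symm]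
        ring
    simp only [Matrix.sub_apply, Matrix.smul_apply, Matrix.sum_apply, h1, dephase_apply,
      ← Finset.sum_mul, h2, Complex.real_smul]
    push_cast
    split_ifs <;> ring
  rw [e]
  exact h.smul (by norm_num)

/-- The dephased state is separable, so the pinching inequality bounds the max-relative entropy of
entanglement by the logarithm of the dimension of `B`, whatever the size of `A`. -/
lemma emaxState_le_logb_card [DecidableEq A] [DecidableEq B]
    {ρ : Matrix (A × B) (A × B) ℂ} (hρ : IsState ρ) :
    EmaxState ρ ≤ ((Real.logb 2 (Fintype.card B)).toNNReal : ℝ≥0∞) := by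
  have hB : 1 ≤ Fintype.card B := by
    rw [Nat.one_le_iff_ne_zero, Ne, Fintype.card_eq_zero_iff]
    intro hB
    exact zero_ne_one (α := ℂ) (by simpa [Matrix.trace] using hρ.2)
  have hB' : (1 : ℝ) ≤ Fintype.card B := by exact_mod_cast hB
  refine iInf₂_le_of_le (dephase ρ) (isSeparable_iff.2 ⟨dephase_mem_sepCone hρ.1, ?_⟩)
    (iInf₂_le_of_le _ ?_ le_rfl)
  · rw [trace_dephase, hρ.2]
  · rw [Real.coe_toNNReal _ (Real.logb_nonneg one_lt_two hB'),
      Real.rpow_logb two_pos (by norm_num) (by linarith)]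
    exact posSemidef_card_smul_dephase_sub hρ.1

variable {a b : ℕ} {T : Matrix (Fin a) (Fin a) ℂ →ₗ[ℂ] Matrix (Fin b) (Fin b) ℂ}

lemma IsQuantumChannel.emax_ne_top (hT : IsQuantumChannel T) : Emax T ≠ ⊤ := by
  refine ne_top_of_le_ne_top (ENNReal.coe_ne_top (r := (Real.logb 2 b).toNNReal))
    (iSup_le fun n => iSup₂_le fun ρ hρ => ?_)
  simpa using emaxState_le_logb_card (ρ := applySnd T ρ)
    ⟨hT.posSemidef_applySnd hρ.1, (hT.trace_applySnd ρ).trans hρ.2⟩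

/-- For `Emax T < l` and positive semidefinite `X` on `R ⊗ A'`, the matrix `(id ⊗ T) X` lies below a
separable one of trace `2 ^ l * tr X`. -/
lemma exists_dominating_applySnd {l : ℝ≥0} (hl : Emax T < l) {n : ℕ}
    {X : Matrix (Fin n × Fin a) (Fin n × Fin a) ℂ} (hX : X.PosSemidef) :
    ∃ W ∈ sepCone (Fin n) (Fin b), W.trace = (2 : ℝ) ^ (l : ℝ) • X.trace ∧
      (W - applySnd T X).PosSemidef := by
  by_cases h0 : X.trace = 0
  · rw [hX.trace_eq_zero_iff] at h0
    subst h0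
    exact ⟨0, zero_mem _, by simp, by simpa [applySnd_zero] using PosSemidef.zero⟩
  obtain ⟨hpos, htr, hst, hXe⟩ := isState_inv_trace_smul hX h0
  have hlt : EmaxState (applySnd T ((X.trace.re)⁻¹ • X)) < l :=
    lt_of_le_of_lt (le_iSup_of_le n (le_iSup₂_of_le
      (f := fun ρ (_ : IsState ρ) => EmaxState (applySnd T ρ)) _ hst le_rfl)) hl
  obtain ⟨σ, hσ, h⟩ := exists_isSeparable_of_emaxState_lt hlt
  obtain ⟨hσ1, hσ2⟩ := isSeparable_iff.1 hσ
  refine ⟨X.trace.re • (2 : ℝ) ^ (l : ℝ) • σ, smul_mem_sepCone hpos.le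
    (smul_mem_sepCone (by positivity) hσ1), ?_, ?_⟩
  · rw [trace_smul, trace_smul, hσ2, smul_comm]
    conv_rhs => rw [htr]
    simp
  · have h' := h.smul hpos.le
    rwa [smul_sub, ← applySnd_smul, ← hXe] at h'

/-- A bipartite matrix of trace one that lies, in the Loewner order, below an element of trace `c`
of the separable cone. For a state `X` and `c = 2 ^ l` with `0 ≤ l` this means `X ≤ 2 ^ l • σ` for a
separable state `σ`, which bounds the max-relative entropy of entanglement of `X` by `l`. -/
def IsDominated (c : ℝ) (X : Matrix (A × B) (A × B) ℂ) : Prop :=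
  X.trace = 1 ∧ ∃ Z ∈ sepCone A B, Z.trace = (c : ℂ) ∧ (Z - X).PosSemidef

lemma IsSeparable.isDominated {X : Matrix (A × B) (A × B) ℂ} (hX : IsSeparable X) :
    IsDominated 1 X :=
  ⟨(isSeparable_iff.1 hX).2, X, (isSeparable_iff.1 hX).1, by simp [(isSeparable_iff.1 hX).2],
    by simpa using PosSemidef.zero⟩

lemma IsDominated.map {A' B' : Type*} [Fintype A'] [Fintype B'] {c : ℝ}
    {X : Matrix (A × B) (A × B) ℂ} (hX : IsDominated c X)
    {f : Matrix (A × B) (A × B) ℂ →ₗ[ℂ] Matrix (A' × B') (A' × B') ℂ} (hf : IsSepOperation f) :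
    IsDominated c (f X) := by
  obtain ⟨h1, Z, hZ, hZc, hZX⟩ := hX
  refine ⟨by rw [hf.trace, h1], f Z, hf.sepCone _ hZ, by rw [hf.trace, hZc], ?_⟩
  rw [← map_sub]
  exact hf.posSemidef _ hZX

omit [Fintype A] in
/-- On a product `X ⊗ Y` across the cut `A A' : B`, the channel acts on `X` alone, and a separable
upper bound across `A : B'` stays separable across `A : B' B` after tensoring with `Y`. Hence one use
of `T` increases the trace of the separable upper bound by a factor of at most `2 ^ l`, even in the
presence of the memories. -/
lemma exists_dominating_useChannel {l : ℝ≥0} (hl : Emax T < l) {n : ℕ}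
    {Z : Matrix ((Fin n × Fin a) × B) ((Fin n × Fin a) × B) ℂ}
    (hZ : Z ∈ sepCone (Fin n × Fin a) B) :
    ∃ W ∈ sepCone (Fin n) (Fin b × B), W.trace = (2 : ℝ) ^ (l : ℝ) • Z.trace ∧
      (W - useChannel T Z).PosSemidef := by
  induction hZ using AddSubmonoid.closure_induction with
  | mem Z h =>
    obtain ⟨X, Y, hX, hY, rfl⟩ := h
    obtain ⟨W, hW, hWt, hWX⟩ := exists_dominating_applySnd hl hX
    refine ⟨_, kronecker_submatrix_prodAssoc_mem_sepCone hW hY, ?_, ?_⟩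
    · rw [trace_kronecker, ← smul_mul_assoc, ← hWt, ← trace_kronecker]
      exact Equiv.sum_comp (Equiv.prodAssoc _ _ _).symm fun i => (W ⊗ₖ Y) i i
    · have e : W ⊗ₖ Y - applySnd T X ⊗ₖ Y = (W - applySnd T X) ⊗ₖ Y := by
        rw [sub_eq_iff_eq_add, ← add_kronecker, sub_add_cancel]
      have h := (hWX.kronecker hY).submatrix (Equiv.prodAssoc (Fin n) (Fin b) B).symm
      rw [← e] at h
      rwa [useChannel_kronecker]
  | zero => exact ⟨0, zero_mem _, by simp, by simpa [useChannel_zero] using PosSemidef.zero⟩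
  | add X Y _ _ hX hY =>
    obtain ⟨W, hW, hWt, hWX⟩ := hX
    obtain ⟨V, hV, hVt, hVY⟩ := hY
    refine ⟨W + V, add_mem hW hV, by rw [trace_add, trace_add, hWt, hVt, smul_add], ?_⟩
    rw [useChannel_add, add_sub_add_comm]
    exact hWX.add hVY

/-- One use of the channel costs at most a factor `2 ^ l` in the separable upper bound. -/
lemma IsDominated.useChannel (hT : IsQuantumChannel T) {l : ℝ≥0} (hl : Emax T < l) {n : ℕ} {c : ℝ}
    {X : Matrix ((Fin n × Fin a) × B) ((Fin n × Fin a) × B) ℂ} (hX : IsDominated c X) :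
    IsDominated ((2 : ℝ) ^ (l : ℝ) * c) (useChannel T X) := by
  obtain ⟨h1, Z, hZ, hZc, hZX⟩ := hX
  obtain ⟨W, hW, hWt, hWX⟩ := exists_dominating_useChannel hl hZ
  refine ⟨by rw [hT.trace_useChannel, h1], W, hW, by rw [hWt, hZc]; simp, ?_⟩
  have h := hWX.add (hT.posSemidef_useChannel hZX)
  have e : PrivCap.useChannel T Z = PrivCap.useChannel T (Z - X) + PrivCap.useChannel T X := by
    rw [← useChannel_add, sub_add_cancel]
  rwa [e, sub_add_eq_sub_sub, sub_right_comm, sub_add_cancel] at h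

variable {m : ℕ} {At Bt : Type} [Fintype At] [Fintype Bt]

omit [Fintype At] [Fintype Bt] in
lemma CodingScheme.isDominated_state (hT : IsQuantumChannel T) {l : ℝ≥0} (hl : Emax T < l)
    (S : CodingScheme T m At Bt) (i : ℕ) (hi : i < m) :
    IsDominated (((2 : ℝ) ^ (l : ℝ)) ^ i) (S.state i) := by
  induction i with
  | zero =>
    rw [pow_zero]
    exact S.init_sep.isDominated
  | succ i ih =>
    obtain ⟨f, hf, hfe⟩ := (S.op_locc i hi).exists_isSepOperation
    have h := ((ih (by omega)).useChannel hT hl).map hf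
    rw [hfe, ← pow_succ'] at h
    exact h

/-- The output of a coding scheme with `m` channel uses lies below a separable matrix of trace
`2 ^ (m * l)`, for every `l` above `Emax T`. -/
lemma CodingScheme.isDominated_output (hT : IsQuantumChannel T) {l : ℝ≥0} (hl : Emax T < l)
    (S : CodingScheme T m At Bt) : IsDominated (((2 : ℝ) ^ (l : ℝ)) ^ m) S.output := by
  obtain ⟨f, hf, hfe⟩ := S.last_locc.exists_isSepOperation
  have hm := S.pos
  have h := ((S.isDominated_state hT hl (m - 1) (by omega)).useChannel hT hl).map hf
  rw [hfe, ← pow_succ', Nat.sub_add_cancel hm] at h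
  exact h

end Emax

/-! ### The trace norm -/

section TraceNorm

variable {n : Type*} [Fintype n]

lemma conjTranspose_mul_self_apply_diag {m : Type*} (Z : Matrix n m ℂ) (i : m) :
    (Zᴴ * Z) i i = ((∑ x, ‖Z x i‖ ^ 2 : ℝ) : ℂ) := by
  simp only [Matrix.mul_apply, conjTranspose_apply, Complex.ofReal_sum]
  exact Finset.sum_congr rfl fun x _ => by
    rw [Complex.star_def, Complex.conj_mul', Complex.ofReal_pow]

lemma traceNorm_nonneg [DecidableEq n] (X : Matrix n n ℂ) : 0 ≤ traceNorm X :=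
  Finset.sum_nonneg fun _ _ => Real.sqrt_nonneg _

/-- The trace norm dominates `|tr (W X)|` for every unitary `W`: in an orthonormal eigenbasis `u i`
of `Xᴴ X`, the Cauchy-Schwarz inequality bounds the diagonal entries `⟨Wᴴ u i, X u i⟩` by
`‖X u i‖`, which is the `i`-th singular value. -/
lemma norm_trace_mul_le_traceNorm [DecidableEq n] {W : Matrix n n ℂ}
    (hW : W ∈ unitaryGroup n ℂ) (X : Matrix n n ℂ) : ‖(W * X).trace‖ ≤ traceNorm X := by
  let hH := isHermitian_conjTranspose_mul_self X
  let U : Matrix n n ℂ := hH.eigenvectorUnitary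
  have hU : Uᴴ * U = 1 := mem_unitaryGroup_iff'.1 hH.eigenvectorUnitary.2
  have hU' : U * Uᴴ = 1 := mem_unitaryGroup_iff.1 hH.eigenvectorUnitary.2
  have hZ : (Wᴴ * U)ᴴ * (Wᴴ * U) = 1 := by
    rw [conjTranspose_mul, conjTranspose_conjTranspose, Matrix.mul_assoc, ← Matrix.mul_assoc W,
      ← star_eq_conjTranspose, ← star_eq_conjTranspose, mem_unitaryGroup_iff.1 hW, Matrix.one_mul]
    exact hU
  have hY : (X * U)ᴴ * (X * U) = diagonal (fun i => (hH.eigenvalues i : ℂ)) := by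
    have h := hH.conjStarAlgAut_star_eigenvectorUnitary
    rw [Unitary.conjStarAlgAut_star_apply] at h
    rw [conjTranspose_mul, Matrix.mul_assoc, ← Matrix.mul_assoc Xᴴ, ← Matrix.mul_assoc]
    exact h
  have htr : (W * X).trace = ∑ i, ((Wᴴ * U)ᴴ * (X * U)) i i := by
    change _ = ((Wᴴ * U)ᴴ * (X * U)).trace
    rw [conjTranspose_mul, conjTranspose_conjTranspose, Matrix.mul_assoc, trace_mul_comm Uᴴ,
      Matrix.mul_assoc, Matrix.mul_assoc, hU', Matrix.mul_one]
  rw [htr]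
  refine (norm_sum_le _ _).trans (Finset.sum_le_sum fun i _ => ?_)
  have h1 : ∑ x, ‖(Wᴴ * U) x i‖ ^ 2 = 1 := by
    have h := conjTranspose_mul_self_apply_diag (Wᴴ * U) i
    rw [hZ, one_apply_eq] at h
    exact_mod_cast h.symm
  have h2 : ∑ x, ‖(X * U) x i‖ ^ 2 = hH.eigenvalues i := by
    have h := conjTranspose_mul_self_apply_diag (X * U) i
    rw [hY, diagonal_apply_eq] at h
    exact_mod_cast h.symm
  rw [← h2, Matrix.mul_apply]
  calc ‖∑ x, ((Wᴴ * U)ᴴ) i x * (X * U) x i‖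
      ≤ ∑ x, ‖(Wᴴ * U) x i‖ * ‖(X * U) x i‖ :=
        (norm_sum_le _ _).trans_eq (Finset.sum_congr rfl fun x _ => by
          rw [norm_mul, conjTranspose_apply, norm_star])
    _ ≤ √(∑ x, ‖(Wᴴ * U) x i‖ ^ 2) * √(∑ x, ‖(X * U) x i‖ ^ 2) :=
        Real.sum_mul_le_sqrt_mul_sqrt _ _ _
    _ = √(∑ x, ‖(X * U) x i‖ ^ 2) := by rw [h1, Real.sqrt_one, one_mul]

end TraceNorm

/-! ### The privacy test -/

section PrivacyTest

variable {K d : ℕ}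

/-- The operator `∑ i, ⟨i i| ⊗ (U i i)ᴴ` from `(A_k ⊗ A_s) ⊗ (B_k ⊗ B_s)` to `A_s ⊗ B_s`. Up to the
factor `1 / K`, the projection of the privacy test, which untwists and then projects the key part
onto the maximally entangled state, is `Vᴴ * V` for this operator `V`. -/
def untwist (U : Fin K → Fin K → Matrix (Fin d × Fin d) (Fin d × Fin d) ℂ) :
    Matrix (Fin d × Fin d) ((Fin K × Fin d) × (Fin K × Fin d)) ℂ :=
  Matrix.of fun s p => if p.1.1 = p.2.1 then (U p.1.1 p.1.1)ᴴ s (p.1.2, p.2.2) else 0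

variable {U : Fin K → Fin K → Matrix (Fin d × Fin d) (Fin d × Fin d) ℂ}

lemma untwist_mul_conjTranspose (hU : ∀ i j, U i j ∈ unitaryGroup (Fin d × Fin d) ℂ) :
    untwist U * (untwist U)ᴴ = (K : ℂ) • 1 := by
  have h : untwist U * (untwist U)ᴴ = ∑ i, (U i i)ᴴ * (U i i) := by
    ext s t
    simp only [untwist, Matrix.mul_apply, conjTranspose_apply, of_apply, Matrix.sum_apply,
      Fintype.sum_prod_type, apply_ite star, star_zero, mul_ite, ite_mul, mul_zero, zero_mul,
      star_star]
    refine Finset.sum_congr rfl fun i _ => Finset.sum_congr rfl fun u _ => ?_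
    rw [Finset.sum_eq_single i]
    · simp
    · intro j _ hj
      simp [hj.symm]
    · simp
  rw [h]
  simp only [fun i => show (U i i)ᴴ * U i i = 1 from mem_unitaryGroup_iff'.1 (hU i i)]
  simp [Nat.cast_smul_eq_nsmul]

lemma twisting_apply (p q : (Fin K × Fin K) × (Fin d × Fin d)) :
    twisting U p q = if p.1 = q.1 then U p.1.1 p.1.2 p.2 q.2 else 0 := by
  obtain ⟨⟨i, j⟩, s⟩ := p
  obtain ⟨⟨i', j'⟩, t⟩ := q
  simp only [twisting, Matrix.sum_apply, kroneckerMap_apply, single_self_apply, Prod.mk.injEq]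
  rw [Finset.sum_eq_single i, Finset.sum_eq_single j]
  · simp only [eq_comm (a := i'), eq_comm (a := j'), ite_and]
    split_ifs <;> simp
  · intro x _ hx
    simp [hx.symm]
  · simp
  · intro x _ hx
    simp [hx.symm]
  · simp

lemma privateState_eq_untwist (σ : Matrix (Fin d × Fin d) (Fin d × Fin d) ℂ) :
    (twisting U * (maxEntangled K ⊗ₖ σ) * (twisting U)ᴴ).submatrix
      (Equiv.prodProdProdComm (Fin K) (Fin d) (Fin K) (Fin d))
      (Equiv.prodProdProdComm (Fin K) (Fin d) (Fin K) (Fin d)) =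
    (1 / (K : ℂ)) • ((untwist U)ᴴ * σ * untwist U) := by
  have h1 : ∀ (p q : Fin K × Fin K) (s t : Fin d × Fin d),
      (twisting U * (maxEntangled K ⊗ₖ σ) * (twisting U)ᴴ) (p, s) (q, t) =
        maxEntangled K p q * (U p.1 p.2 * σ * (U q.1 q.2)ᴴ) s t := by
    intro p q s t
    simp only [Matrix.mul_apply, conjTranspose_apply, twisting_apply, kroneckerMap_apply,
      Fintype.sum_prod_type (α₁ := Fin K × Fin K), apply_ite star, star_zero, ite_mul, mul_ite,
      zero_mul, mul_zero, Finset.sum_ite_irrel, Finset.sum_const_zero, Finset.sum_ite_eq,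
      Finset.mem_univ, if_true, Finset.mul_sum, Finset.sum_mul]
    refine Finset.sum_congr rfl fun x _ => Finset.sum_congr rfl fun y _ => ?_
    ring
  ext ⟨⟨i, u⟩, ⟨j, v⟩⟩ ⟨⟨i', u'⟩, ⟨j', v'⟩⟩
  simp only [submatrix_apply, Equiv.prodProdProdComm_apply, h1]
  simp only [maxEntangled, of_apply, Matrix.smul_apply, smul_eq_mul]
  by_cases hij : i = j
  · by_cases hij' : i' = j'
    · subst hij hij'
      simp [Matrix.mul_apply, untwist]
    · simp [Matrix.mul_apply, untwist, hij']
  · simp [Matrix.mul_apply, untwist, hij]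

lemma norm_toLp_mulVec_of_unitary {n : Type*} [Fintype n] [DecidableEq n] {U : Matrix n n ℂ}
    (hU : Uᴴ * U = 1) (f : n → ℂ) : ‖WithLp.toLp 2 (U *ᵥ f)‖ = ‖WithLp.toLp 2 f‖ := by
  have key : ∀ g : n → ℂ, ((‖WithLp.toLp 2 g‖ ^ 2 : ℝ) : ℂ) = star g ⬝ᵥ g := by
    intro g
    rw [EuclideanSpace.norm_sq_eq, Complex.ofReal_sum]
    refine Finset.sum_congr rfl fun i _ => ?_
    rw [Pi.star_apply, Complex.star_def, Complex.conj_mul', Complex.ofReal_pow]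
  have h : ‖WithLp.toLp 2 (U *ᵥ f)‖ ^ 2 = ‖WithLp.toLp 2 f‖ ^ 2 := by
    apply Complex.ofReal_injective
    rw [key, key, star_mulVec, ← dotProduct_mulVec, mulVec_mulVec, hU, one_mulVec]
  exact (sq_eq_sq₀ (norm_nonneg _) (norm_nonneg _)).1 h

/-- On product vectors, `untwist U` is a contraction: the triangle inequality over the key index
followed by the Cauchy-Schwarz inequality. -/
lemma sum_norm_sq_untwist_mulVec_le (hU : ∀ i j, U i j ∈ unitaryGroup (Fin d × Fin d) ℂ)
    (f g : Fin K × Fin d → ℂ) :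
    ∑ s, ‖(untwist U *ᵥ fun p => f p.1 * g p.2) s‖ ^ 2 ≤
      (∑ x, ‖f x‖ ^ 2) * ∑ y, ‖g y‖ ^ 2 := by
  let w : Fin K → Fin d × Fin d → ℂ := fun i r => f (i, r.1) * g (i, r.2)
  have e : WithLp.toLp 2 (untwist U *ᵥ fun p => f p.1 * g p.2)
      = ∑ i, WithLp.toLp 2 ((U i i)ᴴ *ᵥ w i) := by
    ext s
    simp only [untwist, mulVec, dotProduct, of_apply, WithLp.ofLp_sum, Finset.sum_apply,
      Fintype.sum_prod_type, ite_mul, zero_mul, w]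
    refine Finset.sum_congr rfl fun i _ => Finset.sum_congr rfl fun u _ => ?_
    rw [Finset.sum_eq_single i]
    · simp
    · intro j _ hj
      simp [hj.symm]
    · simp
  have hw : ∀ i, ‖WithLp.toLp 2 ((U i i)ᴴ *ᵥ w i)‖
      = √(∑ u, ‖f (i, u)‖ ^ 2) * √(∑ v, ‖g (i, v)‖ ^ 2) := by
    intro i
    rw [norm_toLp_mulVec_of_unitary (by
      rw [conjTranspose_conjTranspose]; exact mem_unitaryGroup_iff.1 (hU i i)),
      EuclideanSpace.norm_eq, ← Real.sqrt_mul (Finset.sum_nonneg fun _ _ => by positivity),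
      Finset.sum_mul_sum]
    simp [w, Fintype.sum_prod_type, mul_pow]
  have h1 : ‖WithLp.toLp 2 (untwist U *ᵥ fun p => f p.1 * g p.2)‖
      ≤ √(∑ x, ‖f x‖ ^ 2) * √(∑ y, ‖g y‖ ^ 2) := by
    rw [e]
    refine (norm_sum_le _ _).trans ?_
    simp only [hw]
    refine (Real.sum_mul_le_sqrt_mul_sqrt _ _ _).trans_eq ?_
    simp only [Real.sq_sqrt (Finset.sum_nonneg fun (_ : Fin d) _ => sq_nonneg ‖_‖),
      Fintype.sum_prod_type]
  have h2 := pow_le_pow_left₀ (norm_nonneg _) h1 2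
  rwa [mul_pow, Real.sq_sqrt (Finset.sum_nonneg fun _ _ => sq_nonneg _),
    Real.sq_sqrt (Finset.sum_nonneg fun _ _ => sq_nonneg _), EuclideanSpace.norm_sq_eq] at h2

/-- An element `Z` of the separable cone passes the privacy test with weight at most `tr Z / K`. -/
lemma trace_untwist_le (hU : ∀ i j, U i j ∈ unitaryGroup (Fin d × Fin d) ℂ)
    {Z : Matrix ((Fin K × Fin d) × (Fin K × Fin d)) ((Fin K × Fin d) × (Fin K × Fin d)) ℂ}
    (hZ : Z ∈ sepCone (Fin K × Fin d) (Fin K × Fin d)) :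
    (untwist U * Z * (untwist U)ᴴ).trace ≤ Z.trace := by
  let F : Matrix ((Fin K × Fin d) × (Fin K × Fin d)) ((Fin K × Fin d) × (Fin K × Fin d)) ℂ →+ ℂ :=
    { toFun := fun Z => Z.trace - (untwist U * Z * (untwist U)ᴴ).trace
      map_zero' := by simp
      map_add' := fun X Y => by simp [Matrix.mul_add, Matrix.add_mul]; ring }
  have hsum : ∀ f : Fin K × Fin d → ℂ, f ⬝ᵥ star f = ((∑ x, ‖f x‖ ^ 2 : ℝ) : ℂ) := by
    intro f
    rw [Complex.ofReal_sum]
    refine Finset.sum_congr rfl fun i _ => ?_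
    rw [Pi.star_apply, Complex.star_def, Complex.mul_conj', Complex.ofReal_pow]
  have hpure : ∀ f g : Fin K × Fin d → ℂ,
      0 ≤ F (vecMulVec f (star f) ⊗ₖ vecMulVec g (star g)) := by
    intro f g
    have e : vecMulVec f (star f) ⊗ₖ vecMulVec g (star g)
        = vecMulVec (fun p : (Fin K × Fin d) × (Fin K × Fin d) => f p.1 * g p.2)
            (star fun p => f p.1 * g p.2) := by
      ext p q
      simp [vecMulVec_apply]
      ring
    have h1 : (vecMulVec f (star f) ⊗ₖ vecMulVec g (star g)).trace
        = (((∑ x, ‖f x‖ ^ 2) * ∑ y, ‖g y‖ ^ 2 : ℝ) : ℂ) := by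
      rw [trace_kronecker, trace_vecMulVec, trace_vecMulVec, hsum, hsum, Complex.ofReal_mul]
    have h2 : (untwist U * (vecMulVec f (star f) ⊗ₖ vecMulVec g (star g)) * (untwist U)ᴴ).trace
        = ((∑ s, ‖(untwist U *ᵥ fun p => f p.1 * g p.2) s‖ ^ 2 : ℝ) : ℂ) := by
      rw [e, mul_vecMulVec, vecMulVec_mul, ← star_mulVec, trace_vecMulVec, Complex.ofReal_sum]
      refine Finset.sum_congr rfl fun i _ => ?_
      rw [Pi.star_apply, Complex.star_def, Complex.mul_conj', Complex.ofReal_pow]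
    change (0 : ℂ) ≤ _ - _
    rw [h1, h2, sub_nonneg]
    exact_mod_cast sum_norm_sq_untwist_mulVec_le hU f g
  have h : F Z ∈ AddSubmonoid.nonneg ℂ := by
    refine map_mem_of_mem_sepCone F _ (fun X Y hX hY => ?_) hZ
    obtain ⟨m, f, rfl⟩ := posSemidef_iff_eq_sum_vecMulVec.1 hX
    obtain ⟨m', g, rfl⟩ := posSemidef_iff_eq_sum_vecMulVec.1 hY
    have e : (∑ i, vecMulVec (f i) (star (f i))) ⊗ₖ (∑ j, vecMulVec (g j) (star (g j)))
        = ∑ i, ∑ j, vecMulVec (f i) (star (f i)) ⊗ₖ vecMulVec (g j) (star (g j)) := by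
      ext p q
      simp only [Matrix.sum_apply, kroneckerMap_apply, Finset.sum_mul_sum]
    rw [e, map_sum]
    refine sum_mem fun i _ => ?_
    rw [map_sum]
    exact sum_mem fun j _ => hpure _ _
  exact sub_nonneg.1 h

/-- A matrix below a separable one of trace `c` has trace distance at least `1 - c / K` from every
private state with `K`-dimensional key part: the two are told apart by the privacy test. -/
lemma IsDominated.one_sub_le (hK : K ≠ 0) {c : ℝ}
    {φ : Matrix ((Fin K × Fin d) × (Fin K × Fin d)) ((Fin K × Fin d) × (Fin K × Fin d)) ℂ}
    (hφ : IsDominated c φ)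
    {γ : Matrix ((Fin K × Fin K) × (Fin d × Fin d)) ((Fin K × Fin K) × (Fin d × Fin d)) ℂ}
    (hγ : IsPrivateState K d γ) :
    1 - c / K ≤ 1 / 2 * traceNorm (φ - γ.submatrix
      (Equiv.prodProdProdComm (Fin K) (Fin d) (Fin K) (Fin d))
      (Equiv.prodProdProdComm (Fin K) (Fin d) (Fin K) (Fin d))) := by
  obtain ⟨σ, U, hσ, hU, rfl⟩ := hγ
  obtain ⟨hφ1, Z, hZ, hZc, hZφ⟩ := hφ
  rw [privateState_eq_untwist]
  set V := untwist U
  have hVV : V * Vᴴ = (K : ℂ) • 1 := untwist_mul_conjTranspose hU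
  have hK' : (K : ℂ) ≠ 0 := by exact_mod_cast hK
  -- the reflection `2 Π - 1` in the projection `Π` of the privacy test
  let W := (2 / (K : ℂ)) • (Vᴴ * V) - 1
  have hWs : star W = W := by
    simp [W, star_eq_conjTranspose]
  have hP : (Vᴴ * V) * (Vᴴ * V) = (K : ℂ) • (Vᴴ * V) := by
    rw [Matrix.mul_assoc, ← Matrix.mul_assoc V, hVV, Matrix.smul_mul, Matrix.one_mul,
      Matrix.mul_smul]
  have hW : W ∈ unitaryGroup _ ℂ := by
    rw [mem_unitaryGroup_iff, hWs]
    have h4 : (2 / (K : ℂ)) * ((2 / (K : ℂ)) * K) = 2 / (K : ℂ) + 2 / (K : ℂ) := by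
      field_simp; norm_num
    simp only [W, Matrix.sub_mul, Matrix.mul_sub, Matrix.smul_mul, Matrix.mul_smul, hP,
      Matrix.one_mul, Matrix.mul_one, smul_sub, smul_smul, h4, add_smul]
    abel
  have htr : ∀ X, (W * X).trace = (2 / (K : ℂ)) * (V * X * Vᴴ).trace - X.trace := by
    intro X
    rw [Matrix.sub_mul, trace_sub, Matrix.one_mul, Matrix.smul_mul, trace_smul, smul_eq_mul,
      Matrix.mul_assoc, trace_mul_comm]
  have hγ1 : (W * ((1 / (K : ℂ)) • (Vᴴ * σ * V))).trace = 1 := by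
    have e1 : V * (Vᴴ * σ * V) * Vᴴ = ((K : ℂ) * K) • σ := by
      rw [Matrix.mul_assoc, Matrix.mul_assoc _ V, hVV, ← Matrix.mul_assoc V, ← Matrix.mul_assoc V,
        hVV]
      simp [smul_smul]
    have e2 : (Vᴴ * σ * V).trace = K := by
      rw [trace_mul_comm, ← Matrix.mul_assoc, hVV]
      simp [hσ.2]
    rw [htr, Matrix.mul_smul, Matrix.smul_mul, e1, trace_smul, trace_smul, trace_smul, hσ.2, e2]
    simp only [smul_eq_mul]
    field_simp
    norm_num
  have hφW : ((W * φ).trace).re ≤ 2 / K * c - 1 := by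
    have h1 : (V * φ * Vᴴ).trace ≤ c := by
      refine le_trans ?_ ((trace_untwist_le hU hZ).trans_eq hZc)
      have h := (hZφ.mul_mul_conjTranspose_same V).trace_nonneg
      rwa [Matrix.mul_sub, Matrix.sub_mul, trace_sub, sub_nonneg] at h
    have h2 := (Complex.le_def.1 h1).1
    rw [htr, hφ1, show (2 / (K : ℂ)) = ((2 / K : ℝ) : ℂ) by push_cast; rfl, Complex.sub_re,
      Complex.re_ofReal_mul, Complex.one_re]
    rw [Complex.ofReal_re] at h2
    gcongr
  have h := (Complex.abs_re_le_norm _).trans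
    (norm_trace_mul_le_traceNorm hW (φ - (1 / (K : ℂ)) • (Vᴴ * σ * V)))
  rw [Matrix.mul_sub, trace_sub, hγ1, Complex.sub_re, Complex.one_re] at h
  have h' := (neg_abs_le ((W * φ).trace.re - 1))
  have : c / K = 2 / K * c / 2 := by ring
  linarith

end PrivacyTest

end PrivCap

theorem lemma3 {a b : ℕ} (T : Matrix (Fin a) (Fin a) ℂ →ₗ[ℂ] Matrix (Fin b) (Fin b) ℂ)
    (hT : PrivCap.IsQuantumChannel T) (α : ℝ) (hα : 1 < α) (k m d : ℕ) (ε : ℝ)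
    (S : PrivCap.CodingScheme T m (Fin (2 ^ k) × Fin d) (Fin (2 ^ k) × Fin d))
    (hS : S.IsPrivate ε) :
    PrivCap.Emax T ≠ ⊤ ∧
      ε ≥ 1 - (2 : ℝ) ^ (-((α - 1) / (2 * α)) * ((k : ℝ) - (m : ℝ) * (PrivCap.Emax T).toReal)) := by
  have htop := hT.emax_ne_top
  refine ⟨htop, ?_⟩
  set E := (PrivCap.Emax T).toReal
  obtain ⟨γ, hγ, hε⟩ := hS
  have hε0 : 0 ≤ ε := by
    rw [hε]
    exact mul_nonneg (by norm_num) (PrivCap.traceNorm_nonneg _)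
  have h1 : ∀ x : ℝ, E < x → 1 - (2 : ℝ) ^ (m * x - k) ≤ ε := by
    intro x hx
    have hx0 : 0 ≤ x := ENNReal.toReal_nonneg.trans hx.le
    lift x to ℝ≥0 using hx0
    have hl : PrivCap.Emax T < x := by
      rw [← ENNReal.ofReal_coe_nnreal]
      exact (ENNReal.lt_ofReal_iff_toReal_lt htop).2 hx
    have h := (S.isDominated_output hT hl).one_sub_le (by positivity) hγ
    rw [← hε] at h
    convert h using 2
    rw [Real.rpow_sub two_pos, mul_comm, Real.rpow_mul two_pos.le]
    simp
  -- the bound needs `Emax T` strictly below `x`, since an infimum may not be attained; hence the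
  -- limit `x ↓ E`
  have h2 : 1 - (2 : ℝ) ^ (m * E - k) ≤ ε := by
    have hc : Continuous fun x : ℝ => 1 - (2 : ℝ) ^ (m * x - k) :=
      continuous_const.sub (Continuous.rpow continuous_const (by fun_prop) fun _ => by simp)
    exact le_of_tendsto (hc.continuousWithinAt (s := Set.Ioi E) (x := E))
      (Filter.eventually_of_mem self_mem_nhdsWithin h1)
  have hs0 : 0 < (α - 1) / (2 * α) := by
    have : 0 < α - 1 := by linarith
    positivity
  have hs1 : (α - 1) / (2 * α) ≤ 1 := by
    rw [div_le_one (by positivity)]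
    linarith
  -- the factor in the exponent lies in `(0, 1]`, so the bound just proved is the stronger one
  -- whenever `0 ≤ k - m E`
  rcases le_total 0 ((k : ℝ) - m * E) with hk | hk
  · have h3 : (2 : ℝ) ^ (m * E - k) ≤ (2 : ℝ) ^ (-((α - 1) / (2 * α)) * ((k : ℝ) - m * E)) := by
      apply Real.rpow_le_rpow_of_exponent_le one_le_two
      nlinarith
    linarith
  · -- here the exponent on the right is nonnegative, so that the bound is trivial
    have h3 : 1 ≤ (2 : ℝ) ^ (-((α - 1) / (2 * α)) * ((k : ℝ) - m * E)) := by
      apply Real.one_le_rpow one_le_two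
      nlinarith
    linarith
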